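/- Let $d\ge 1$ and $l\ge 1$ be integers and $\alpha\in(-1,0)$. Let $h:\mathbb{R}^d\times\mathbb{R}^d\to[0,\infty)$ be a $C^\infty$ function, bounded together with each of its partial derivatives, such that for some constant $C$ one has $h(x,y)=0$ for all $x$ and all $|y|>C$. For smooth $f:\mathbb{R}^d\to\mathbb{C}$ put $$Lf(x)=(-1)^{l+1}\int_{\mathbb{R}^d}\Big(f(x+y)-f(x)-\sum_{i=1}^{2l}\frac{1}{i!}\langle y^{\otimes i},D^if(x)\rangle\Big)\frac{h(x,y)}{|y|^{2l+1+\alpha}}\,dy .$$ If $h(x,0)=1$ for all $x$, then the integral converges absolutely for every $C^\infty$ function $f$ and every $x$, and $L$ is an elliptic pseudodifferential operator of order $2l$. That is, there is a $C^\infty$ function $a:\mathbb{R}^d\times\mathbb{R}^d\to\mathbb{C}$ such that (i) for all integers $r,j\ge 0$ there is a constant $C_{r,j}$ with $|D_x^rD_\xi^ja(x,\xi)|\le C_{r,j}|\xi|^{2l-j}+C_{r,j}$ for all $x,\xi$ with $\xi\neq0$, and $|D_x^rD_\xi^ja(x,0)|$ is bounded in $x$; (ii) there are constants $c>0$ and $R$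 with $|a(x,\xi)|\ge c|\xi|^{2l}$ for all $x$ and all $|\xi|>R$; (iii) for every Schwartz function $f$ and every $x$, $$Lf(x)=(2\pi)^{-d}\int_{\mathbb{R}^d}e^{i\langle x,\xi\rangle}a(x,\xi)\hat f(\xi)\,d\xi,\qquad \hat f(\xi)=\int_{\mathbb{R}^d}e^{-i\langle z,\xi\rangle}f(z)\,dz .$$ -/

import Mathlib

open MeasureTheory
open scoped ContDiff SchwartzMap FourierTransform Nat

/-- The compensated increment
`f (x + y) - f x - ∑_{i = 1}^{2l} ⟨y^{⊗ i}, D^i f x⟩ / i!`. -/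
noncomputable def compensatedIncrement {d : ℕ} (l : ℕ) (f : EuclideanSpace ℝ (Fin d) → ℂ)
    (x y : EuclideanSpace ℝ (Fin d)) : ℂ :=
  f (x + y) - f x - ∑ i ∈ Finset.Icc 1 (2 * l), ((i ! : ℂ))⁻¹ * iteratedFDeriv ℝ i f x (fun _ => y)

/-- The integrand of the operator: the compensated increment times the density
`h (x, y) / |y| ^ (2l + 1 + α)` of the Lévy measure. -/
noncomputable def levyIntegrand {d : ℕ} (l : ℕ) (α : ℝ)
    (h : EuclideanSpace ℝ (Fin d) → EuclideanSpace ℝ (Fin d) → ℝ)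
    (f : EuclideanSpace ℝ (Fin d) → ℂ) (x y : EuclideanSpace ℝ (Fin d)) : ℂ :=
  compensatedIncrement l f x y * ((h x y / ‖y‖ ^ (2 * (l : ℝ) + 1 + α) : ℝ) : ℂ)

/-- The integro-differential operator
`L f x = (-1)^(l+1) ∫ (f (x+y) - f x - ∑_{i=1}^{2l} ⟨y^{⊗ i}, D^i f x⟩ / i!)
  h (x, y) / |y| ^ (2l+1+α) dy`. -/
noncomputable def levyOperator {d : ℕ} (l : ℕ) (α : ℝ)
    (h : EuclideanSpace ℝ (Fin d) → EuclideanSpace ℝ (Fin d) → ℝ)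
    (f : EuclideanSpace ℝ (Fin d) → ℂ) (x : EuclideanSpace ℝ (Fin d)) : ℂ :=
  (-1) ^ (l + 1) * ∫ y, levyIntegrand l α h f x y

/-- `a` is a symbol of order `m`: it is smooth, and for all orders `r`, `j` there is a constant `C`
with `|D_x^r D_ξ^j a (x, ξ)| ≤ C |ξ|^(m - j) + C` for all `x` and `ξ`. -/
structure IsSymbolOfOrder {d : ℕ}
    (a : EuclideanSpace ℝ (Fin d) → EuclideanSpace ℝ (Fin d) → ℂ) (m : ℝ) : Prop where
  smooth : ContDiff ℝ ∞ (Function.uncurry a)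
  bound : ∀ r j : ℕ, ∃ C : ℝ, ∀ x ξ : EuclideanSpace ℝ (Fin d),
    ‖iteratedFDeriv ℝ r (fun x' => iteratedFDeriv ℝ j (fun ξ' => a x' ξ') ξ) x‖
      ≤ C * ‖ξ‖ ^ (m - (j : ℝ)) + C

/-- `a` is elliptic of order (at least) `m' > 0`: `|a (x, ξ)| ≥ c |ξ|^m'` for all `x` and all large
`ξ`, uniformly in `x`. -/
def IsEllipticSymbol {d : ℕ}
    (a : EuclideanSpace ℝ (Fin d) → EuclideanSpace ℝ (Fin d) → ℂ) (m' : ℝ) : Prop :=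
  0 < m' ∧ ∃ c R : ℝ, 0 < c ∧ ∀ x ξ : EuclideanSpace ℝ (Fin d), R < ‖ξ‖ →
    c * ‖ξ‖ ^ m' ≤ ‖a x ξ‖

/-- The operator with symbol `a`,
`f ↦ (2π)^(-d) ∫ exp (i ⟨x, η⟩) a (x, η) (∫ exp (-i ⟨z, η⟩) f z dz) dη`,
written after the substitution `η = 2π ξ` with Mathlib's Fourier transform
`𝓕 f ξ = ∫ exp (-2π i ⟨z, ξ⟩) f z dz`. -/
noncomputable def symbolOperator {d : ℕ}
    (a : EuclideanSpace ℝ (Fin d) → EuclideanSpace ℝ (Fin d) → ℂ)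
    (f : EuclideanSpace ℝ (Fin d) → ℂ) (x : EuclideanSpace ℝ (Fin d)) : ℂ :=
  ∫ ξ : EuclideanSpace ℝ (Fin d),
    Complex.exp (((2 * Real.pi * inner ℝ x ξ : ℝ) : ℂ) * Complex.I)
      * a x ((2 * Real.pi) • ξ) * 𝓕 f ξ

/-- `T` is a pseudodifferential operator of order `m` on `ℝ^d` that is elliptic of order `m'`:
on Schwartz functions it is the operator of a symbol of order `m`, elliptic of order `m'`. -/
def IsEllipticPseudodifferential {d : ℕ}
    (T : (EuclideanSpace ℝ (Fin d) → ℂ) → EuclideanSpace ℝ (Fin d) → ℂ) (m m' : ℝ) : Prop :=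
  ∃ a : EuclideanSpace ℝ (Fin d) → EuclideanSpace ℝ (Fin d) → ℂ,
    IsSymbolOfOrder a m ∧ IsEllipticSymbol a m' ∧
      ∀ (f : 𝓢(EuclideanSpace ℝ (Fin d), ℂ)) (x : EuclideanSpace ℝ (Fin d)),
        T (fun z => f z) x = symbolOperator a (fun z => f z) x

/-! Put `E_n(t) = e^{it} - ∑_{i<n} (it)^i/i!`, which is `expTail`. By Fourier inversion the
compensated increment of a Schwartz function multiplies its transform by `E_{2l+1}(⟨y,ξ⟩)`
(`compensatedIncrement_schwartz`), so Fubini gives the symbol `(-1)^(l+1) ∫ h(x,y) E_{2l+1}(⟨y,ξ⟩)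
|y|^{-(2l+1+α)} dy` (`levyOperator_schwartz`).

Everything rests on `|E_{n+1}(t)| ≤ min(|t|^{n+1}, 2|t|^n)`. With `n = 2l` it leaves the density
`|y|^{-1-α}`, integrable on balls since `α < 0`. Each `ξ`-derivative lowers the order of the tail by
one and brings out a factor `y`, while `x`-derivatives fall on `h` alone; this yields smoothness and
the symbol estimates (`contDiff_levySymbol`, `norm_iteratedFDeriv_levySymbol_le`).

For ellipticity, split `E_{2l+1}(t) = E_{2l}(t) - (it)^{2l}/(2l)!`. The monomial contributes a term
of constant sign and size at least a multiple of `|ξ|^{2l}`, because `h` is near `1` for small `y`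
(`exists_le_integral_inner_pow`). The rest is `O(|ξ|^{2l+α/2})`, of lower order
(`exists_norm_integral_expTail_le`). -/

/-! ### Differentiation of parametric integrals. -/

section ParametricIntegral

variable {P F Y : Type*} [NormedAddCommGroup P] [NormedSpace ℝ P] [NormedAddCommGroup F]
  [NormedSpace ℝ F]

/-- Differentiation under the integral sign to all orders. -/
theorem hasFTaylorSeriesUpTo_integral [MeasurableSpace Y] {μ : Measure Y} {G : P → Y → F}
    (hG : ∀ y, ContDiff ℝ ∞ (G · y))
    (hm : ∀ n p, AEStronglyMeasurable (fun y => iteratedFDeriv ℝ n (G · y) p) μ)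
    (hb : ∀ (n : ℕ) (p : P), ∃ s ∈ nhds p, ∃ b : Y → ℝ, Integrable b μ ∧
      ∀ q ∈ s, ∀ y, ‖iteratedFDeriv ℝ n (G · y) q‖ ≤ b y) :
    HasFTaylorSeriesUpTo ∞ (fun p => ∫ y, G p y ∂μ)
      (fun p n => ∫ y, iteratedFDeriv ℝ n (G · y) p ∂μ) := by
  have hint : ∀ n p, Integrable (fun y => iteratedFDeriv ℝ n (G · y) p) μ := by
    intro n p
    obtain ⟨s, hs, b, hbi, hbb⟩ := hb n p
    exact hbi.mono' (hm n p) (Filter.Eventually.of_forall (hbb p (mem_of_mem_nhds hs)))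
  refine (hasFTaylorSeriesUpTo_top_iff' le_rfl).2 ⟨fun p => ?_, fun n p => ?_⟩
  · exact ((continuousMultilinearCurryFin0 ℝ P F).toContinuousLinearEquiv.integral_comp_comm
      (μ := μ) (fun y => iteratedFDeriv ℝ 0 (G · y) p)).symm
  · obtain ⟨s, hs, b, hbi, hbb⟩ := hb (n + 1) p
    have key := hasFDerivAt_integral_of_dominated_of_fderiv_le (𝕜 := ℝ) (μ := μ)
      (F := fun q y => iteratedFDeriv ℝ n (G · y) q)
      (F' := fun q y => (iteratedFDeriv ℝ (n + 1) (G · y) q).curryLeft) (bound := b) hs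
      (Filter.Eventually.of_forall fun q => hm n q) (hint n p)
      ((continuousMultilinearCurryLeftEquiv ℝ
        (fun _ : Fin (n + 1) => P) F).continuous.comp_aestronglyMeasurable
        (hm (n + 1) p)) ?_ hbi ?_
    · refine key.congr_fderiv ?_
      exact (ContinuousLinearEquiv.integral_comp_comm (𝕜 := ℝ) (E := P [×(n + 1)]→L[ℝ] F)
        (F := P →L[ℝ] P [×n]→L[ℝ] F) (continuousMultilinearCurryLeftEquiv ℝ
        (fun _ : Fin (n + 1) => P) F).toContinuousLinearEquiv
        (μ := μ) (fun y => iteratedFDeriv ℝ (n + 1) (G · y) p))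
    · refine Filter.Eventually.of_forall fun y q hq => ?_
      rw [ContinuousMultilinearMap.curryLeft_norm]
      exact hbb q hq y
    · refine Filter.Eventually.of_forall fun y q _ => ?_
      exact ((hG y).ftaylorSeries).fderiv n (by exact_mod_cast WithTop.coe_lt_top _) q

variable [NormedAddCommGroup Y] [NormedSpace ℝ Y]

theorem iteratedFDeriv_partial_left {g : P × Y → F} (hg : ContDiff ℝ ∞ g) (n : ℕ) (p : P) (y : Y) :
    iteratedFDeriv ℝ n (fun q => g (q, y)) p =
      (iteratedFDeriv ℝ n g (p, y)).compContinuousLinearMap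
        fun _ => ContinuousLinearMap.inl ℝ P Y := by
  have h1 : (fun q => g (q, y)) =
      (fun z => g (z + (0, y))) ∘ ContinuousLinearMap.inl ℝ P Y := by
    ext q; simp
  rw [h1, ContinuousLinearMap.iteratedFDeriv_comp_right (n := ∞) _ (by fun_prop) _
    (by exact_mod_cast le_top), iteratedFDeriv_comp_add_right]
  simp

/-- Continuity in the frozen variable `y` is what makes the differentiated integrands measurable. -/
theorem contDiff_iteratedFDeriv_partial_left {g : P × Y → F} (hg : ContDiff ℝ ∞ g) (n : ℕ) :
    ContDiff ℝ ∞ (fun z : P × Y => iteratedFDeriv ℝ n (fun q => g (q, z.2)) z.1) := by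
  simp_rw [iteratedFDeriv_partial_left hg]
  exact (ContinuousMultilinearMap.compContinuousLinearMapL
    (fun _ : Fin n => ContinuousLinearMap.inl ℝ P Y)).contDiff.comp
      (hg.iteratedFDeriv_right (m := ∞) (i := n) le_rfl)

theorem norm_iteratedFDeriv_partial_left_le {g : P × Y → F} (hg : ContDiff ℝ ∞ g) (n : ℕ) (p : P)
    (y : Y) : ‖iteratedFDeriv ℝ n (fun q => g (q, y)) p‖ ≤ ‖iteratedFDeriv ℝ n g (p, y)‖ := by
  rw [iteratedFDeriv_partial_left hg]
  refine (ContinuousMultilinearMap.norm_compContinuousLinearMap_le _ _).trans ?_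
  refine mul_le_of_le_one_right (norm_nonneg _) (Finset.prod_le_one (fun _ _ => norm_nonneg _) ?_)
  exact fun _ _ => ContinuousLinearMap.norm_inl_le_one ℝ P Y

theorem norm_iteratedFDeriv_comp_right_le {Q : Type*} [NormedAddCommGroup Q] [NormedSpace ℝ Q]
    {f : P → F} (hf : ContDiff ℝ ∞ f) (L : Q →L[ℝ] P) (n : ℕ) (q : Q) :
    ‖iteratedFDeriv ℝ n (fun q => f (L q)) q‖ ≤ ‖iteratedFDeriv ℝ n f (L q)‖ * ‖L‖ ^ n := by
  have := L.iteratedFDeriv_comp_right hf q (i := n) (by exact_mod_cast le_top)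
  rw [Function.comp_def] at this
  rw [this]
  refine (ContinuousMultilinearMap.norm_compContinuousLinearMap_le _ _).trans ?_
  simp

/-- Differentiation under the integral sign to all orders, for an integrand that is smooth up to a
weight depending only on the integration variable. -/
theorem hasFTaylorSeriesUpTo_integral_smul [FiniteDimensional ℝ Y] [MeasurableSpace Y]
    [BorelSpace Y] {μ : Measure Y} {g : P × Y → F} (hg : ContDiff ℝ ∞ g) {w : Y → ℝ}
    (hw : Measurable w)
    (hb : ∀ (n : ℕ) (p : P), ∃ s ∈ nhds p, ∃ b : Y → ℝ, Integrable b μ ∧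
      ∀ q ∈ s, ∀ y, |w y| * ‖iteratedFDeriv ℝ n (fun p => g (p, y)) q‖ ≤ b y) :
    HasFTaylorSeriesUpTo ∞ (fun p => ∫ y, w y • g (p, y) ∂μ)
      (fun p n => ∫ y, w y • iteratedFDeriv ℝ n (fun q => g (q, y)) p ∂μ) := by
  have := FiniteDimensional.proper ℝ Y
  have hpar : ∀ y, ContDiff ℝ ∞ (fun q => g (q, y)) := fun y => by fun_prop
  have hd : ∀ n p y, iteratedFDeriv ℝ n (fun q => w y • g (q, y)) p =
      w y • iteratedFDeriv ℝ n (fun q => g (q, y)) p := fun n p y =>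
    iteratedFDeriv_const_smul_apply' ((hpar y).of_le (by exact_mod_cast le_top)).contDiffAt
  have := hasFTaylorSeriesUpTo_integral (μ := μ) (G := fun p y => w y • g (p, y))
    (fun y => (hpar y).const_smul _) (fun n p => ?_) (fun n p => ?_)
  · simpa only [hd] using this
  · simp only [hd]
    exact hw.aestronglyMeasurable.smul ((contDiff_iteratedFDeriv_partial_left hg n).continuous.comp
      (Continuous.prodMk_right p)).aestronglyMeasurable
  · simpa only [hd, norm_smul, Real.norm_eq_abs] using hb n p

end ParametricIntegral

/-! ### Remainders of the imaginary exponential. -/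

section ExpTail

/-- The remainder of order `n` of the exponential series at the imaginary point `i t`. -/
noncomputable def expTail (n : ℕ) (t : ℝ) : ℂ :=
  Complex.exp (t * Complex.I) - ∑ i ∈ Finset.range n, ((i ! : ℂ))⁻¹ * (t * Complex.I) ^ i

theorem expTail_succ (n : ℕ) (t : ℝ) :
    expTail (n + 1) t = expTail n t - ((n ! : ℂ))⁻¹ * (t * Complex.I) ^ n := by
  rw [expTail, expTail, Finset.sum_range_succ]; ring

/-- Differentiation shifts the Taylor polynomial by one degree. Truncated subtraction is right at `n
= 0`, where the tail is the full exponential and reproduces itself. -/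
theorem hasDerivAt_expTail (n : ℕ) (t : ℝ) :
    HasDerivAt (expTail n) (Complex.I * expTail (n - 1) t) t := by
  have h1 : HasDerivAt (fun t : ℝ => (t : ℂ) * Complex.I) Complex.I t := by
    simpa using (Complex.ofRealCLM.hasDerivAt (x := t)).mul_const Complex.I
  induction n with
  | zero =>
    have : expTail 0 = fun t : ℝ => Complex.exp (t * Complex.I) := by ext; simp [expTail]
    rw [this]
    simpa [mul_comm] using h1.cexp
  | succ n ih =>
    have : expTail (n + 1) = fun t : ℝ => expTail n t - ((n ! : ℂ))⁻¹ * (t * Complex.I) ^ n :=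
      funext (expTail_succ n)
    rw [this]
    refine (ih.sub ((h1.pow n).const_mul _)).congr_deriv ?_
    rcases n with _ | n
    · simp
    · simp only [Nat.add_sub_cancel]
      rw [expTail_succ, Nat.factorial_succ]
      push_cast
      have : (n : ℂ) + 1 ≠ 0 := by exact_mod_cast n.succ_ne_zero
      field_simp

theorem iteratedDeriv_expTail (n j : ℕ) :
    iteratedDeriv j (expTail n) = fun t => Complex.I ^ j * expTail (n - j) t := by
  induction j with
  | zero => simp
  | succ j ih =>
    rw [iteratedDeriv_succ, ih]
    ext t
    rw [((hasDerivAt_expTail (n - j) t).const_mul _).deriv, Nat.sub_sub]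
    ring

theorem contDiff_expTail (n : ℕ) : ContDiff ℝ ∞ (expTail n) := by
  unfold expTail
  have h1 : ContDiff ℝ ∞ (fun t : ℝ => (t : ℂ)) := Complex.ofRealCLM.contDiff
  fun_prop

theorem norm_expTail_zero (t : ℝ) : ‖expTail 0 t‖ = 1 := by
  simp [expTail, Complex.norm_exp_ofReal_mul_I]

/-- Induction by the mean value inequality: the tail of order `n + 1` vanishes at `0`, and its
derivative has the modulus of the tail of order `n`. -/
theorem norm_expTail_le (n : ℕ) (t : ℝ) : ‖expTail n t‖ ≤ |t| ^ n := by
  induction n generalizing t with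
  | zero => simp [norm_expTail_zero]
  | succ n ih =>
    have h0 : expTail (n + 1) 0 = 0 := by
      simp [expTail, Finset.sum_range_succ']
    have := (convex_uIcc (0 : ℝ) t).norm_image_sub_le_of_norm_hasDerivWithin_le (C := |t| ^ n)
      (f := expTail (n + 1)) (fun s _ => (hasDerivAt_expTail (n + 1) s).hasDerivWithinAt)
      (fun s hs => ?_) Set.left_mem_uIcc Set.right_mem_uIcc
    · simpa [h0, pow_succ] using this
    · rw [norm_mul, Complex.norm_I, one_mul, Nat.add_sub_cancel]
      refine (ih s).trans (pow_le_pow_left₀ (abs_nonneg _) ?_ n)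
      simpa using Set.abs_sub_left_of_mem_uIcc hs

/-- Splitting off the last monomial costs one power at `0` but gains one at infinity. -/
theorem norm_expTail_succ_le (n : ℕ) (t : ℝ) : ‖expTail (n + 1) t‖ ≤ 2 * |t| ^ n := by
  rw [expTail_succ, two_mul]
  refine (norm_sub_le _ _).trans (add_le_add (norm_expTail_le n t) ?_)
  rw [norm_mul, norm_pow, norm_mul, Complex.norm_I, mul_one, Complex.norm_real, norm_inv,
    Complex.norm_natCast, Real.norm_eq_abs]
  exact mul_le_of_le_one_left (by positivity)
    (inv_le_one_of_one_le₀ (by exact_mod_cast n.factorial_pos))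

variable {E : Type*} [NormedAddCommGroup E] [InnerProductSpace ℝ E]

theorem norm_iteratedFDeriv_expTail_inner_le (n j : ℕ) (y ξ : E) :
    ‖iteratedFDeriv ℝ j (fun ξ => expTail n (inner ℝ y ξ)) ξ‖ ≤
      ‖expTail (n - j) (inner ℝ y ξ)‖ * ‖y‖ ^ j := by
  refine (norm_iteratedFDeriv_comp_right_le (contDiff_expTail n) (innerSL ℝ y) j ξ).trans ?_
  rw [norm_iteratedFDeriv_eq_norm_iteratedDeriv, iteratedDeriv_expTail, innerSL_apply_norm]
  simp

/-- Each `ξ`-derivative trades a factor `‖ξ‖` for a factor `‖y‖`, so the power `‖y‖ ^ N` survives.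
Beyond `N` derivatives the tail is a unimodular exponential, and the surplus powers of `‖y‖` are
absorbed by `‖y‖ ≤ C`. -/
theorem exists_norm_iteratedFDeriv_expTail_inner_le (N j : ℕ) {C : ℝ} (hC : 0 ≤ C) :
    ∃ M : ℝ, 0 ≤ M ∧ ∀ y ξ : E, ‖y‖ ≤ C →
      ‖iteratedFDeriv ℝ j (fun ξ => expTail (N + 1) (inner ℝ y ξ)) ξ‖ ≤
        M * (‖ξ‖ ^ (N - j) + 1) * ‖y‖ ^ N := by
  rcases le_or_gt j N with hj | hj
  · refine ⟨2, by norm_num, fun y ξ _ => (norm_iteratedFDeriv_expTail_inner_le _ _ _ _).trans ?_⟩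
    obtain ⟨k, rfl⟩ := Nat.exists_eq_add_of_le hj
    rw [show j + k + 1 - j = k + 1 by omega, show j + k - j = k by omega]
    calc ‖expTail (k + 1) (inner ℝ y ξ)‖ * ‖y‖ ^ j
        ≤ (2 * (‖y‖ * ‖ξ‖) ^ k) * ‖y‖ ^ j := by
          gcongr
          refine (norm_expTail_succ_le _ _).trans ?_
          gcongr
          exact abs_real_inner_le_norm y ξ
      _ = 2 * (‖ξ‖ ^ k) * ‖y‖ ^ (j + k) := by ring
      _ ≤ _ := by gcongr; linarith
  · refine ⟨C ^ (j - N), by positivity, fun y ξ hy =>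
      (norm_iteratedFDeriv_expTail_inner_le _ _ _ _).trans ?_⟩
    rw [show N + 1 - j = 0 by omega, norm_expTail_zero, one_mul]
    calc ‖y‖ ^ j = ‖y‖ ^ (j - N) * 1 * ‖y‖ ^ N := by
          rw [mul_one, ← pow_add, Nat.sub_add_cancel hj.le]
      _ ≤ _ := by
        gcongr
        exact le_add_of_nonneg_left (by positivity)

end ExpTail

/-! ### Integrability of the singular weight. -/

section Weight

variable {E : Type*} [NormedAddCommGroup E]

/-- The weight `|y| ^ (-(2l + 1 + α))`. -/
noncomputable def levyWeight (l : ℕ) (α : ℝ) (y : E) : ℝ := (‖y‖ ^ (2 * (l : ℝ) + 1 + α))⁻¹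

theorem levyWeight_nonneg (l : ℕ) (α : ℝ) (y : E) : 0 ≤ levyWeight l α y := by
  unfold levyWeight; positivity

/-- The `2l`-th moment density of the weight, cut off outside a ball. -/
noncomputable def truncatedMoment (l : ℕ) (α C : ℝ) : E → ℝ :=
  (Metric.closedBall (0 : E) C).indicator fun y => levyWeight l α y * ‖y‖ ^ (2 * l)

theorem truncatedMoment_nonneg (l : ℕ) (α C : ℝ) (y : E) : 0 ≤ truncatedMoment l α C y :=
  Set.indicator_nonneg (fun _ _ => mul_nonneg (levyWeight_nonneg _ _ _) (by positivity)) _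

/-- An estimate by the `2l`-th power of the norm on a ball, and vanishing outside, gives domination by
the truncated moment. -/
theorem levyWeight_mul_le_truncatedMoment {l : ℕ} {α C A t : ℝ} {y : E}
    (h : ‖y‖ ≤ C → t ≤ A * ‖y‖ ^ (2 * l)) (h0 : C < ‖y‖ → t = 0) :
    levyWeight l α y * t ≤ A * truncatedMoment l α C y := by
  rcases le_or_gt ‖y‖ C with hy | hy
  · rw [truncatedMoment, Set.indicator_of_mem (by simpa using hy)]
    calc _ ≤ levyWeight l α y * (A * ‖y‖ ^ (2 * l)) :=
          mul_le_mul_of_nonneg_left (h hy) (levyWeight_nonneg _ _ _)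
      _ = _ := by ring
  · rw [truncatedMoment, Set.indicator_of_notMem (by simpa using hy), h0 hy]; simp

variable [MeasurableSpace E] [BorelSpace E]

theorem measurable_levyWeight (l : ℕ) (α : ℝ) : Measurable (levyWeight l α : E → ℝ) :=
  (measurable_norm.pow_const _).inv

variable [InnerProductSpace ℝ E] [FiniteDimensional ℝ E]

/-- In polar coordinates the radial density is `t ^ (dim E - 1 + s)`, with exponent above `-1`. -/
theorem integrableOn_norm_rpow_closedBall [Nontrivial E] {s : ℝ} (hs : -(Module.finrank ℝ E : ℝ) < s)
    (C : ℝ) : IntegrableOn (fun y : E => ‖y‖ ^ s) (Metric.closedBall 0 C) := by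
  refine IntegrableOn.mono_set ?_
    (Metric.closedBall_subset_ball (lt_of_le_of_lt (le_abs_self C) (lt_add_one |C|)))
  rw [integrableOn_fun_norm_addHaar volume (f := fun t : ℝ => t ^ s)]
  have hd : 1 ≤ Module.finrank ℝ E := Module.finrank_pos
  have h := (intervalIntegral.integrableOn_Ioo_rpow_iff (s := ((Module.finrank ℝ E - 1 : ℕ) : ℝ) + s)
    (t := |C| + 1) (by positivity)).2 (by push_cast [hd]; linarith)
  refine h.congr_fun (fun t ht => ?_) measurableSet_Ioo
  simp only [smul_eq_mul]
  rw [Real.rpow_add ht.1, Real.rpow_natCast]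

theorem integrableOn_levyWeight_mul_rpow [Nontrivial E] {l : ℕ} {α s : ℝ} (hα : -1 < α)
    (hs : 2 * (l : ℝ) + α < s) (C : ℝ) :
    IntegrableOn (fun y : E => levyWeight l α y * ‖y‖ ^ s) (Metric.closedBall 0 C) := by
  have hd : (1 : ℝ) ≤ Module.finrank ℝ E := by exact_mod_cast Module.finrank_pos (R := ℝ) (M := E)
  refine (integrableOn_norm_rpow_closedBall (s := s - (2 * l + 1 + α)) (by linarith) C).mono'
    ((measurable_levyWeight l α).mul (measurable_norm.pow_const _)).aestronglyMeasurable
    (Filter.Eventually.of_forall fun y => ?_)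
  rw [Real.norm_of_nonneg (mul_nonneg (levyWeight_nonneg _ _ _) (by positivity)), levyWeight]
  rcases eq_or_ne y 0 with rfl | hy
  -- At the origin the inverse of zero makes the weight `0`, so the bound is trivial there.
  · have : 2 * (l : ℝ) + 1 + α ≠ 0 := by have := l.cast_nonneg (α := ℝ); linarith
    simp [Real.zero_rpow this, Real.rpow_nonneg]
  · rw [Real.rpow_sub (norm_pos_iff.2 hy), div_eq_inv_mul]

theorem integrable_truncatedMoment [Nontrivial E] (l : ℕ) {α : ℝ} (hα : α ∈ Set.Ioo (-1 : ℝ) 0)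
    (C : ℝ) : Integrable (truncatedMoment l α C : E → ℝ) := by
  have := integrableOn_levyWeight_mul_rpow (E := E) (l := l) (s := 2 * l) hα.1
    (by linarith [hα.2]) C
  rw [← integrable_indicator_iff Metric.isClosed_closedBall.measurableSet] at this
  exact_mod_cast this

end Weight

/-! ### Smoothness of the symbol and bounds on its derivatives. -/

section Symbol

variable {E F : Type*} [NormedAddCommGroup E] [InnerProductSpace ℝ E]
  [NormedAddCommGroup F] [NormedSpace ℝ F]

/-- The symbol of the Lévy operator, up to sign. -/
noncomputable def levySymbol [MeasurableSpace E] [BorelSpace E] [FiniteDimensional ℝ E]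
    (l : ℕ) (α : ℝ) (h : E → E → ℝ) (x ξ : E) : ℂ :=
  ∫ y, levyWeight l α y • (h x y • expTail (2 * l + 1) (inner ℝ y ξ))

/-- A smooth density with bounded derivatives, supported in `|y| ≤ C`. -/
structure IsLevyDensity (h : E → E → ℝ) (C : ℝ) (B : ℕ → ℝ) : Prop where
  smooth : ContDiff ℝ ∞ (Function.uncurry h)
  radius_nonneg : 0 ≤ C
  bound : ∀ n p, ‖iteratedFDeriv ℝ n (Function.uncurry h) p‖ ≤ B n
  supp : ∀ x y, C < ‖y‖ → h x y = 0

namespace IsLevyDensity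

variable {h : E → E → ℝ} {C : ℝ} {B : ℕ → ℝ} (H : IsLevyDensity h C B)
include H

theorem bound_nonneg (n : ℕ) : 0 ≤ B n := (norm_nonneg _).trans (H.bound n 0)

theorem norm_iteratedFDeriv_left_le (n : ℕ) (x y : E) : ‖iteratedFDeriv ℝ n (h · y) x‖ ≤ B n :=
  (norm_iteratedFDeriv_partial_left_le H.smooth n x y).trans (H.bound n _)

theorem abs_le (x y : E) : |h x y| ≤ B 0 := by
  simpa using H.bound 0 (x, y)

theorem iteratedFDeriv_smul_eq_zero {P : Type*} [NormedAddCommGroup P] [NormedSpace ℝ P] (n : ℕ)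
    {y : E} (hy : C < ‖y‖) (u : P → E) (v : P → F) (p : P) :
    iteratedFDeriv ℝ n (fun q => h (u q) y • v q) p = 0 := by
  simp_rw [H.supp _ y hy, zero_smul]
  simp

variable [FiniteDimensional ℝ E] [MeasurableSpace E] [BorelSpace E]

/-- Averages of a function of size `O(|y| ^ 2l)` against the weighted density are smooth, with bounded
derivatives. -/
theorem norm_iteratedFDeriv_average_le [Nontrivial E] {l : ℕ} {α : ℝ} (hα : α ∈ Set.Ioo (-1 : ℝ) 0)
    {V : E → F} (hV : ContDiff ℝ ∞ V) {A : ℝ} (hA : ∀ y, ‖y‖ ≤ C → ‖V y‖ ≤ A * ‖y‖ ^ (2 * l))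
    (r : ℕ) (x : E) :
    ‖iteratedFDeriv ℝ r (fun x => ∫ y, levyWeight l α y • (h x y • V y)) x‖ ≤
      B r * A * ∫ y : E, truncatedMoment l α C y := by
  have hg : ContDiff ℝ ∞ (fun z : E × E => h z.1 z.2 • V z.2) :=
    H.smooth.smul (hV.comp contDiff_snd)
  have hb : ∀ n x y, levyWeight l α y * ‖iteratedFDeriv ℝ n (fun x => h x y • V y) x‖ ≤
      B n * A * truncatedMoment l α C y := by
    intro n x y
    refine levyWeight_mul_le_truncatedMoment (fun hy => ?_) (fun hy => ?_)
    · have hs : ContDiff ℝ ∞ (h · y) := H.smooth.comp (contDiff_prodMk_left y)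
      rw [iteratedFDeriv_smul_const_apply (hs.of_le (by exact_mod_cast le_top)).contDiffAt]
      refine (ContinuousLinearMap.norm_compContinuousMultilinearMap_le _ _).trans ?_
      rw [ContinuousLinearMap.norm_smulRight_apply, mul_comm]
      have h1 := H.norm_iteratedFDeriv_left_le n x y
      calc _ ≤ B n * (1 * (A * ‖y‖ ^ (2 * l))) := by
            gcongr
            · exact H.bound_nonneg n
            · exact ContinuousLinearMap.norm_id_le
            · exact hA y hy
        _ = _ := by ring
    · rw [H.iteratedFDeriv_smul_eq_zero n hy (fun x => x), norm_zero]
  have hT := hasFTaylorSeriesUpTo_integral_smul (μ := volume) hg (measurable_levyWeight l α)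
    (fun n p => ⟨Set.univ, Filter.univ_mem, fun y => B n * A * truncatedMoment l α C y,
      (integrable_truncatedMoment l hα C).const_mul _, fun q _ y => ?_⟩)
  · rw [← hT.eq_iteratedFDeriv (by exact_mod_cast le_top), ← integral_const_mul]
    refine norm_integral_le_of_norm_le ((integrable_truncatedMoment l hα C).const_mul _)
      (Filter.Eventually.of_forall fun y => ?_)
    rw [norm_smul, Real.norm_of_nonneg (levyWeight_nonneg _ _ _)]
    exact hb r x y
  · rw [abs_of_nonneg (levyWeight_nonneg _ _ _)]
    exact hb n q y

omit [FiniteDimensional ℝ E] [MeasurableSpace E] [BorelSpace E] in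
-- Domination for joint derivatives in `(x, ξ)`, by the Leibniz rule. It is uniform only for bounded
-- `ξ`, which suffices because smoothness is local.
theorem exists_levyWeight_mul_norm_iteratedFDeriv_le (l : ℕ) (α : ℝ) (n : ℕ) (R : ℝ) :
    ∃ D : ℝ, ∀ x ξ y : E, ‖ξ‖ ≤ R → levyWeight l α y * ‖iteratedFDeriv ℝ n
      (fun p : E × E => h p.1 y • expTail (2 * l + 1) (inner ℝ y p.2)) (x, ξ)‖ ≤
        D * truncatedMoment l α C y := by
  choose M hM0 hM using fun j => exists_norm_iteratedFDeriv_expTail_inner_le (E := E) (2 * l) j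
    H.radius_nonneg
  refine ⟨∑ i ∈ Finset.range (n + 1), (n.choose i : ℝ) * B i *
    (M (n - i) * (R ^ (2 * l - (n - i)) + 1)), fun x ξ y hξ => ?_⟩
  refine levyWeight_mul_le_truncatedMoment (fun hy => ?_) (fun hy => ?_)
  · have hs : ContDiff ℝ ∞ (h · y) := H.smooth.comp (contDiff_prodMk_left y)
    have he : ContDiff ℝ ∞ (fun ξ : E => expTail (2 * l + 1) (inner ℝ y ξ)) :=
      (contDiff_expTail _).comp (innerSL ℝ y).contDiff
    refine (norm_iteratedFDeriv_smul_le (hs.comp contDiff_fst) (he.comp contDiff_snd) (x, ξ)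
      (by exact_mod_cast le_top)).trans ?_
    rw [Finset.sum_mul]
    refine Finset.sum_le_sum fun i _ => ?_
    have h1 : ‖iteratedFDeriv ℝ i ((h · y) ∘ Prod.fst) (x, ξ)‖ ≤ B i := by
      refine (norm_iteratedFDeriv_comp_right_le hs (ContinuousLinearMap.fst ℝ E E) i (x, ξ)).trans ?_
      refine (mul_le_of_le_one_right (norm_nonneg _) (pow_le_one₀ (norm_nonneg _)
        (ContinuousLinearMap.norm_fst_le ..))).trans (H.norm_iteratedFDeriv_left_le i x y)
    have h2 : ‖iteratedFDeriv ℝ (n - i) ((fun ξ : E => expTail (2 * l + 1) (inner ℝ y ξ)) ∘ Prod.snd)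
        (x, ξ)‖ ≤ M (n - i) * (R ^ (2 * l - (n - i)) + 1) * ‖y‖ ^ (2 * l) := by
      refine (norm_iteratedFDeriv_comp_right_le he (ContinuousLinearMap.snd ℝ E E) _ (x, ξ)).trans ?_
      refine (mul_le_of_le_one_right (norm_nonneg _) (pow_le_one₀ (norm_nonneg _)
        (ContinuousLinearMap.norm_snd_le ..))).trans ((hM _ y ξ hy).trans ?_)
      have := hM0 (n - i)
      gcongr
    calc _ ≤ (n.choose i : ℝ) * B i *
          (M (n - i) * (R ^ (2 * l - (n - i)) + 1) * ‖y‖ ^ (2 * l)) := by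
          gcongr
          exact mul_nonneg (by positivity) (H.bound_nonneg i)
      _ = _ := by ring
  · rw [H.iteratedFDeriv_smul_eq_zero n hy (fun p : E × E => p.1), norm_zero]

theorem contDiff_levySymbol [Nontrivial E] (l : ℕ) {α : ℝ} (hα : α ∈ Set.Ioo (-1 : ℝ) 0) :
    ContDiff ℝ ∞ (Function.uncurry (levySymbol l α h)) := by
  have hg : ContDiff ℝ ∞ (fun z : (E × E) × E =>
      h z.1.1 z.2 • expTail (2 * l + 1) (inner ℝ z.2 z.1.2)) := by
    refine ContDiff.smul (H.smooth.comp (by fun_prop : ContDiff ℝ ∞ fun z : (E × E) × E =>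
      (z.1.1, z.2))) ((contDiff_expTail _).comp ?_)
    exact ContDiff.inner ℝ (by fun_prop) (by fun_prop)
  refine (hasFTaylorSeriesUpTo_integral_smul (μ := volume) hg (measurable_levyWeight l α)
    (fun n p => ?_)).contDiff
  obtain ⟨D, hD⟩ := H.exists_levyWeight_mul_norm_iteratedFDeriv_le l α n (‖p‖ + 1)
  refine ⟨Metric.ball p 1, Metric.ball_mem_nhds _ one_pos, fun y => D * truncatedMoment l α C y,
    (integrable_truncatedMoment l hα C).const_mul _, fun q hq y => ?_⟩
  rw [abs_of_nonneg (levyWeight_nonneg _ _ _)]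
  refine hD q.1 q.2 y ((norm_snd_le q).trans ?_)
  have := norm_le_norm_add_norm_sub' q p
  rw [mem_ball_iff_norm] at hq
  linarith

theorem iteratedFDeriv_levySymbol_right [Nontrivial E] (l : ℕ) {α : ℝ}
    (hα : α ∈ Set.Ioo (-1 : ℝ) 0) (j : ℕ) (x ξ : E) :
    iteratedFDeriv ℝ j (levySymbol l α h x) ξ = ∫ y, levyWeight l α y • (h x y •
      iteratedFDeriv ℝ j (fun ξ => expTail (2 * l + 1) (inner ℝ y ξ)) ξ) := by
  have he : ∀ y : E, ContDiff ℝ ∞ (fun ξ : E => expTail (2 * l + 1) (inner ℝ y ξ)) := fun y =>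
    (contDiff_expTail _).comp (innerSL ℝ y).contDiff
  have hc : ∀ (n : ℕ) (y ξ : E), iteratedFDeriv ℝ n
      (fun ξ => h x y • expTail (2 * l + 1) (inner ℝ y ξ)) ξ =
      h x y • iteratedFDeriv ℝ n (fun ξ => expTail (2 * l + 1) (inner ℝ y ξ)) ξ := fun n y ξ =>
    iteratedFDeriv_const_smul_apply' ((he y).of_le (by exact_mod_cast le_top)).contDiffAt
  have hg : ContDiff ℝ ∞ (fun z : E × E => h x z.2 • expTail (2 * l + 1) (inner ℝ z.2 z.1)) := by
    refine ContDiff.smul (H.smooth.comp (by fun_prop : ContDiff ℝ ∞ fun z : E × E =>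
      (x, z.2))) ((contDiff_expTail _).comp ?_)
    exact ContDiff.inner ℝ (by fun_prop) (by fun_prop)
  have hT := hasFTaylorSeriesUpTo_integral_smul (μ := volume) hg (measurable_levyWeight l α)
    (fun n p => ?_)
  · simp only [← hc]
    exact (hT.eq_iteratedFDeriv (m := j) (by exact_mod_cast le_top) ξ).symm
  · obtain ⟨M, hM0, hM⟩ := exists_norm_iteratedFDeriv_expTail_inner_le (E := E) (2 * l) n
      H.radius_nonneg
    refine ⟨Metric.ball p 1, Metric.ball_mem_nhds _ one_pos, fun y =>
      (B 0 * (M * ((‖p‖ + 1) ^ (2 * l - n) + 1))) * truncatedMoment l α C y,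
      (integrable_truncatedMoment l hα C).const_mul _, fun q hq y => ?_⟩
    rw [abs_of_nonneg (levyWeight_nonneg _ _ _)]
    refine levyWeight_mul_le_truncatedMoment (fun hy => ?_) (fun hy => ?_)
    · rw [hc, norm_smul, Real.norm_eq_abs, mul_assoc]
      have h1 := H.abs_le x y
      have h2 : ‖q‖ ≤ ‖p‖ + 1 := by
        have := norm_le_norm_add_norm_sub' q p
        rw [mem_ball_iff_norm] at hq
        linarith
      refine mul_le_mul h1 ((hM y q hy).trans ?_) (norm_nonneg _) (H.bound_nonneg 0)
      gcongr
    · rw [H.iteratedFDeriv_smul_eq_zero n hy (fun _ => x), norm_zero]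

/-- After the `ξ`-derivatives pass under the integral, `ξ` is frozen and the symbol becomes an
average of a fixed function of `y` against `h x`. The `x`-derivatives then cost only `B r`,
uniformly in `x`. -/
theorem norm_iteratedFDeriv_levySymbol_le [Nontrivial E] (l : ℕ) {α : ℝ}
    (hα : α ∈ Set.Ioo (-1 : ℝ) 0) (r j : ℕ) :
    ∃ K : ℝ, 0 ≤ K ∧ ∀ x ξ : E,
      ‖iteratedFDeriv ℝ r (fun x' => iteratedFDeriv ℝ j (levySymbol l α h x') ξ) x‖ ≤
        K * (‖ξ‖ ^ (2 * l - j) + 1) := by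
  obtain ⟨M, hM0, hM⟩ := exists_norm_iteratedFDeriv_expTail_inner_le (E := E) (2 * l) j
    H.radius_nonneg
  refine ⟨B r * M * ∫ y : E, truncatedMoment l α C y, ?_, fun x ξ => ?_⟩
  · exact mul_nonneg (mul_nonneg (H.bound_nonneg r) hM0)
      (integral_nonneg (truncatedMoment_nonneg l α C))
  · simp only [H.iteratedFDeriv_levySymbol_right l hα]
    have he : ContDiff ℝ ∞ (fun z : E × E => expTail (2 * l + 1) (inner ℝ z.2 z.1)) :=
      (contDiff_expTail _).comp (ContDiff.inner ℝ contDiff_snd contDiff_fst)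
    refine (H.norm_iteratedFDeriv_average_le hα
      (((contDiff_iteratedFDeriv_partial_left he j)).comp (contDiff_prodMk_right ξ))
      (fun y hy => hM y ξ hy) r x).trans_eq ?_
    ring

end IsLevyDensity

end Symbol

/-! ### Lower bound for the symbol. -/

section Ellipticity

variable {E F : Type*} [NormedAddCommGroup E] [InnerProductSpace ℝ E] [NormedAddCommGroup F]
  [NormedSpace ℝ F]

/-- Interpolation: the bound of degree `k + 1` serves for `|t| ≤ 1`, the bound of degree `k` for
`|t| ≥ 1`. -/
theorem norm_expTail_succ_le_rpow {k : ℕ} {s : ℝ} (h1 : (k : ℝ) ≤ s) (h2 : s ≤ k + 1) (t : ℝ) :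
    ‖expTail (k + 1) t‖ ≤ 2 * |t| ^ s := by
  rcases eq_or_ne t 0 with rfl | ht
  · refine (norm_expTail_le (k + 1) 0).trans ?_
    rw [abs_zero, zero_pow k.succ_ne_zero]
    positivity
  · have ht' := abs_pos.2 ht
    rcases le_total |t| 1 with h | h
    · calc ‖expTail (k + 1) t‖ ≤ |t| ^ ((k : ℝ) + 1) := by
            exact_mod_cast norm_expTail_le (k + 1) t
        _ ≤ |t| ^ s := Real.rpow_le_rpow_of_exponent_ge ht' h h2
        _ ≤ 2 * |t| ^ s := by linarith [Real.rpow_nonneg (abs_nonneg t) s]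
    · calc ‖expTail (k + 1) t‖ ≤ 2 * |t| ^ (k : ℝ) := by
            exact_mod_cast norm_expTail_succ_le k t
        _ ≤ 2 * |t| ^ s := by gcongr

namespace IsLevyDensity

variable {h : E → E → ℝ} {C : ℝ} {B : ℕ → ℝ} (H : IsLevyDensity h C B)
include H

theorem half_le (h1 : ∀ x, h x 0 = 1) (x : E) {y : E} (hy : ‖y‖ * (2 * (B 1 + 1)) ≤ 1) :
    1 / 2 ≤ h x y := by
  have key := convex_univ.norm_image_sub_le_of_norm_fderiv_le (𝕜 := ℝ) (f := Function.uncurry h)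
    (C := B 1) (fun p _ => (H.smooth.differentiable (by simp)) p)
    (fun p _ => by rw [← norm_iteratedFDeriv_one]; exact H.bound 1 p)
    (Set.mem_univ (x, (0 : E))) (Set.mem_univ (x, y))
  have h2 : ‖(x, y) - (x, (0 : E))‖ = ‖y‖ := by simp [Prod.norm_def]
  rw [h2, Function.uncurry_apply_pair, Function.uncurry_apply_pair, h1, Real.norm_eq_abs] at key
  have := (_root_.abs_le.1 key).1
  nlinarith [norm_nonneg y, H.bound_nonneg 1]

variable [FiniteDimensional ℝ E] [MeasurableSpace E] [BorelSpace E] [Nontrivial E]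

theorem integrable_levyWeight_smul {l : ℕ} {α : ℝ} (hα : α ∈ Set.Ioo (-1 : ℝ) 0) {V : E → F}
    (hV : Continuous V) {A : ℝ} (hA : ∀ y, ‖y‖ ≤ C → ‖V y‖ ≤ A * ‖y‖ ^ (2 * l)) (x : E) :
    Integrable (fun y => levyWeight l α y • (h x y • V y)) := by
  refine ((integrable_truncatedMoment l hα C).const_mul (B 0 * A)).mono'
    ((measurable_levyWeight l α).aestronglyMeasurable.smul
      (((H.smooth.continuous.comp (Continuous.prodMk_right x)).smul hV).aestronglyMeasurable))
    (Filter.Eventually.of_forall fun y => ?_)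
  rw [norm_smul, Real.norm_of_nonneg (levyWeight_nonneg _ _ _)]
  refine levyWeight_mul_le_truncatedMoment (fun hy => ?_) (fun hy => ?_)
  · rw [norm_smul, mul_assoc]
    exact mul_le_mul (H.abs_le x y) (hA y hy) (norm_nonneg _) (H.bound_nonneg 0)
  · rw [H.supp x y hy, zero_smul, norm_zero]

theorem integrable_levyWeight_smul_inner_pow (l : ℕ) {α : ℝ} (hα : α ∈ Set.Ioo (-1 : ℝ) 0)
    (x ξ : E) :
    Integrable (fun y => levyWeight l α y • (h x y • (inner ℝ y ξ : ℝ) ^ (2 * l))) := by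
  refine H.integrable_levyWeight_smul (A := ‖ξ‖ ^ (2 * l)) hα (by fun_prop) (fun y _ => ?_) x
  rw [norm_pow, ← mul_pow, mul_comm ‖ξ‖]
  gcongr
  exact abs_real_inner_le_norm y ξ

/-- The integrand is nonnegative, so the integral may be restricted to a small ball centred on the
ray through `ξ`. There `h ≥ 1/2`, the weight is at least `1`, and `⟨y, ξ⟩` is comparable to `‖ξ‖`;
the volume of the ball does not depend on its centre. -/
theorem exists_le_integral_inner_pow (h0 : ∀ x y, 0 ≤ h x y) (h1 : ∀ x, h x 0 = 1) (l : ℕ) {α : ℝ}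
    (hα : α ∈ Set.Ioo (-1 : ℝ) 0) : ∃ A : ℝ, 0 < A ∧ ∀ x ξ : E, ξ ≠ 0 →
      A * ‖ξ‖ ^ (2 * l) ≤ ∫ y, levyWeight l α y • (h x y • (inner ℝ y ξ : ℝ) ^ (2 * l)) := by
  have hB := H.bound_nonneg 1
  -- This `δ` is the radius on which `half_le` applies. It is also at most `1`, so that the weight
  -- is at least `1` on the punctured `δ`-ball.
  obtain ⟨δ, hδ, hδB⟩ : ∃ δ : ℝ, 0 < δ ∧ δ * (2 * (B 1 + 1)) = 1 :=
    ⟨(2 * (B 1 + 1))⁻¹, by positivity, inv_mul_cancel₀ (by positivity)⟩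
  have hδ1 : δ ≤ 1 := by nlinarith
  refine ⟨volume.real (Metric.closedBall (0 : E) (δ / 4)) * (1 / 2 * (δ / 4) ^ (2 * l)), ?_,
    fun x ξ hξ => ?_⟩
  · have : 0 < volume.real (Metric.closedBall (0 : E) (δ / 4)) :=
      ENNReal.toReal_pos (Metric.measure_closedBall_pos _ _ (by positivity)).ne'
        measure_closedBall_lt_top.ne
    positivity
  have hξ' : 0 < ‖ξ‖ := norm_pos_iff.2 hξ
  set c : E := (δ / 2 * ‖ξ‖⁻¹) • ξ with hc
  have hcn : ‖c‖ = δ / 2 := by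
    rw [hc, norm_smul, Real.norm_of_nonneg (by positivity), mul_assoc, inv_mul_cancel₀ hξ'.ne',
      mul_one]
  have hcξ : inner ℝ c ξ = δ / 2 * ‖ξ‖ := by
    rw [hc, real_inner_smul_left, real_inner_self_eq_norm_sq]
    field_simp
  have hvol : volume.real (Metric.closedBall c (δ / 4)) =
      volume.real (Metric.closedBall (0 : E) (δ / 4)) := by
    rw [measureReal_def, Measure.addHaar_closedBall_center, measureReal_def]
  have hint : Integrable (fun y => levyWeight l α y • (h x y • (inner ℝ y ξ : ℝ) ^ (2 * l))) :=
    H.integrable_levyWeight_smul_inner_pow l hα x ξ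
  have hnn : ∀ y, 0 ≤ levyWeight l α y • (h x y • (inner ℝ y ξ : ℝ) ^ (2 * l)) := fun y =>
    mul_nonneg (levyWeight_nonneg _ _ _)
      (mul_nonneg (h0 x y) ((even_two_mul l).pow_nonneg _))
  refine le_trans ?_ (setIntegral_le_integral (s := Metric.closedBall c (δ / 4)) hint
    (Filter.Eventually.of_forall hnn))
  rw [← hvol, mul_assoc, ← smul_eq_mul, ← setIntegral_const]
  refine setIntegral_mono_on (integrableOn_const measure_closedBall_lt_top.ne) hint.integrableOn
    Metric.isClosed_closedBall.measurableSet fun y hy => ?_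
  rw [mem_closedBall_iff_norm] at hy
  have hy1 : ‖y‖ ≤ δ := by
    have := norm_le_norm_add_norm_sub' y c
    linarith
  have hy2 : δ / 4 ≤ ‖y‖ := by
    have := norm_le_norm_add_norm_sub' c y
    rw [norm_sub_rev] at this
    linarith
  have hin : δ / 4 * ‖ξ‖ ≤ inner ℝ y ξ := by
    have e : inner ℝ y ξ = inner ℝ c ξ + inner ℝ (y - c) ξ := by
      rw [← inner_add_left, add_sub_cancel]
    have := (_root_.abs_le.1 (abs_real_inner_le_norm (y - c) ξ)).1
    rw [e, hcξ]
    nlinarith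
  -- The lower bound on `‖y‖` matters: at the origin the weight takes the value `0`.
  have hw : 1 ≤ levyWeight l α y := by
    refine (one_le_inv₀ (Real.rpow_pos_of_pos (by linarith) _)).2
      (Real.rpow_le_one (norm_nonneg _) (by linarith) ?_)
    have := l.cast_nonneg (α := ℝ)
    linarith [hα.1]
  have hh : 1 / 2 ≤ h x y := H.half_le h1 x (le_trans (by gcongr) hδB.le)
  calc (1 / 2 * (δ / 4) ^ (2 * l)) * ‖ξ‖ ^ (2 * l) = 1 * (1 / 2 * (δ / 4 * ‖ξ‖) ^ (2 * l)) := by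
        ring
    _ ≤ _ := by
        simp only [smul_eq_mul]
        gcongr

/-- The exponent `s = 2l + α/2` lies strictly between `2l + α`, above which the moment converges,
and `2l`, below which the term is of lower order. Interpolation with `k = 2l - 1` applies at `s`. -/
theorem exists_norm_integral_expTail_le {l : ℕ} (hl : 1 ≤ l) {α : ℝ}
    (hα : α ∈ Set.Ioo (-1 : ℝ) 0) : ∃ D : ℝ, 0 ≤ D ∧ ∀ x ξ : E,
      ‖∫ y, levyWeight l α y • (h x y • expTail (2 * l) (inner ℝ y ξ))‖ ≤
        D * ‖ξ‖ ^ (2 * (l : ℝ) + α / 2) := by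
  set s : ℝ := 2 * (l : ℝ) + α / 2 with hs
  have hl' : (1 : ℝ) ≤ l := by exact_mod_cast hl
  obtain ⟨hα1, hα2⟩ := hα
  have hint := integrableOn_levyWeight_mul_rpow (E := E) (l := l) (s := s) hα1 (by linarith) C
  rw [← integrable_indicator_iff Metric.isClosed_closedBall.measurableSet] at hint
  have hnn : ∀ y : E, 0 ≤ levyWeight l α y * ‖y‖ ^ s := fun y =>
    mul_nonneg (levyWeight_nonneg _ _ _) (by positivity)
  refine ⟨2 * B 0 * ∫ y, (Metric.closedBall (0 : E) C).indicator
    (fun y => levyWeight l α y * ‖y‖ ^ s) y, ?_, fun x ξ => ?_⟩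
  · exact mul_nonneg (mul_nonneg zero_le_two (H.bound_nonneg 0))
      (integral_nonneg (Set.indicator_nonneg fun y _ => hnn y))
  · rw [mul_right_comm, ← integral_const_mul]
    refine norm_integral_le_of_norm_le (hint.const_mul _) (Filter.Eventually.of_forall fun y => ?_)
    rw [norm_smul, Real.norm_of_nonneg (levyWeight_nonneg _ _ _)]
    rcases le_or_gt ‖y‖ C with hy | hy
    · rw [Set.indicator_of_mem (by simpa using hy), norm_smul]
      obtain ⟨k, hk⟩ : ∃ k, 2 * l = k + 1 := ⟨2 * l - 1, by omega⟩
      have hk' : 2 * (l : ℝ) = k + 1 := by exact_mod_cast hk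
      have h2 : ‖expTail (2 * l) (inner ℝ y ξ)‖ ≤ 2 * (‖y‖ * ‖ξ‖) ^ s := by
        rw [hk]
        refine (norm_expTail_succ_le_rpow (s := s) (by linarith) (by linarith) _).trans ?_
        gcongr
        · linarith
        · exact abs_real_inner_le_norm y ξ
      rw [Real.mul_rpow (norm_nonneg _) (norm_nonneg _)] at h2
      calc _ ≤ levyWeight l α y * (B 0 * (2 * (‖y‖ ^ s * ‖ξ‖ ^ s))) := by
            refine mul_le_mul_of_nonneg_left ?_ (levyWeight_nonneg _ _ _)
            exact mul_le_mul (H.abs_le x y) h2 (norm_nonneg _) (H.bound_nonneg 0)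
        _ = _ := by ring
    · rw [Set.indicator_of_notMem (by simpa using hy), H.supp x y hy]
      simp

theorem exists_le_norm_levySymbol (h0 : ∀ x y, 0 ≤ h x y) (h1 : ∀ x, h x 0 = 1) {l : ℕ}
    (hl : 1 ≤ l) {α : ℝ} (hα : α ∈ Set.Ioo (-1 : ℝ) 0) :
    ∃ c R : ℝ, 0 < c ∧ ∀ x ξ : E, R < ‖ξ‖ → c * ‖ξ‖ ^ (2 * l) ≤ ‖levySymbol l α h x ξ‖ := by
  obtain ⟨A, hA, hAle⟩ := H.exists_le_integral_inner_pow h0 h1 l hα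
  obtain ⟨D, hD, hDle⟩ := H.exists_norm_integral_expTail_le hl hα
  set b : ℝ := (((2 * l)! : ℕ) : ℝ)⁻¹ with hb
  have hb0 : 0 < b := by positivity
  -- Relative to `‖ξ‖ ^ (2l)` the remainder is `D ‖ξ‖ ^ (α/2)`, which tends to `0`; beyond `R` it
  -- consumes less than half of the main term.
  have htend := (tendsto_rpow_neg_atTop (y := -α / 2) (by linarith [hα.2])).const_mul D
  rw [mul_zero] at htend
  obtain ⟨R, hR⟩ := Filter.eventually_atTop.1
    (htend.eventually (gt_mem_nhds (show 0 < b * A / 2 by positivity)))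
  refine ⟨b * A / 2, max R 0, by positivity, fun x ξ hξ => ?_⟩
  have hξ0 : 0 < ‖ξ‖ := (le_max_right _ _).trans_lt hξ
  have hint1 : Integrable (fun y => levyWeight l α y • (h x y • expTail (2 * l) (inner ℝ y ξ))) := by
    refine H.integrable_levyWeight_smul (A := ‖ξ‖ ^ (2 * l)) hα
      ((contDiff_expTail _).continuous.comp (by fun_prop)) (fun y _ => ?_) x
    refine (norm_expTail_le _ _).trans ?_
    rw [← mul_pow, mul_comm ‖ξ‖]
    gcongr
    exact abs_real_inner_le_norm y ξ
  have hint2 : Integrable (fun y => levyWeight l α y • (h x y • (inner ℝ y ξ : ℝ) ^ (2 * l))) :=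
    H.integrable_levyWeight_smul_inner_pow l hα x ξ
  have hint3 : Integrable (fun y => (b * (-1) ^ l : ℂ) *
      ((levyWeight l α y • (h x y • (inner ℝ y ξ : ℝ) ^ (2 * l)) : ℝ) : ℂ)) :=
    hint2.ofReal.const_mul _
  have hsplit : levySymbol l α h x ξ =
      (∫ y, levyWeight l α y • (h x y • expTail (2 * l) (inner ℝ y ξ))) - (b * (-1) ^ l : ℂ) *
        ((∫ y, levyWeight l α y • (h x y • (inner ℝ y ξ : ℝ) ^ (2 * l)) : ℝ) : ℂ) := by
    rw [← integral_complex_ofReal, ← integral_const_mul, ← integral_sub hint1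
      hint3, levySymbol]
    refine integral_congr_ae (Filter.Eventually.of_forall fun y => ?_)
    simp only [expTail_succ, smul_sub, Complex.real_smul, smul_eq_mul, mul_pow, pow_mul Complex.I,
      Complex.I_sq, hb]
    push_cast
    ring
  rw [hsplit, norm_sub_rev]
  refine le_trans ?_ (norm_sub_norm_le _ _)
  have e1 : ‖(b * (-1) ^ l : ℂ) *
      ((∫ y, levyWeight l α y • (h x y • (inner ℝ y ξ : ℝ) ^ (2 * l)) : ℝ) : ℂ)‖ ≥
      b * (A * ‖ξ‖ ^ (2 * l)) := by
    rw [norm_mul, norm_mul, norm_pow, norm_neg, norm_one, one_pow, mul_one, Complex.norm_real,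
      Complex.norm_real, Real.norm_of_nonneg hb0.le]
    gcongr
    exact (hAle x ξ (norm_pos_iff.1 hξ0)).trans (le_abs_self _)
  have e2 : D * ‖ξ‖ ^ (2 * (l : ℝ) + α / 2) ≤ b * A / 2 * ‖ξ‖ ^ (2 * l) := by
    have h3 := hR ‖ξ‖ ((le_max_left _ _).trans hξ.le)
    have h4 : ‖ξ‖ ^ (2 * (l : ℝ) + α / 2) = ‖ξ‖ ^ (-(-α / 2)) * ‖ξ‖ ^ (2 * l) := by
      rw [← Real.rpow_natCast ‖ξ‖ (2 * l), ← Real.rpow_add hξ0]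
      congr 1
      push_cast
      ring
    rw [h4, ← mul_assoc]
    gcongr
  linarith [hDle x ξ]

end IsLevyDensity

end Ellipticity

/-! ### Derivatives of Schwartz functions through Fourier inversion. -/

section FourierRepresentation

variable {E : Type*} [NormedAddCommGroup E] [InnerProductSpace ℝ E] [FiniteDimensional ℝ E]
  [MeasurableSpace E] [BorelSpace E]

theorem SchwartzMap.integrable_exp_mul_pow_mul_fourier (f : 𝓢(E, ℂ)) (n : ℕ) (x y : E) :
    Integrable fun ξ : E => Complex.exp (((2 * Real.pi * inner ℝ x ξ : ℝ) : ℂ) * Complex.I) *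
      (((2 * Real.pi * inner ℝ y ξ : ℝ) : ℂ) * Complex.I) ^ n * 𝓕 (fun z => f z) ξ := by
  have hg : Continuous (𝓕 (fun z => f z)) := (𝓕 f).continuous
  refine (((𝓕 f).integrable_pow_mul volume n).const_mul ((2 * Real.pi * ‖y‖) ^ n)).mono'
    (by fun_prop) (Filter.Eventually.of_forall fun ξ => ?_)
  rw [norm_mul, norm_mul, Complex.norm_exp_ofReal_mul_I, one_mul, norm_pow, norm_mul,
    Complex.norm_I, mul_one, Complex.norm_real, norm_mul, Real.norm_of_nonneg Real.two_pi_pos.le,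
    ← mul_assoc, ← mul_pow, mul_assoc _ ‖y‖]
  have := norm_inner_le_norm (𝕜 := ℝ) y ξ
  have h2 := Real.two_pi_pos
  exact mul_le_mul_of_nonneg_right (by gcongr) (norm_nonneg _)

theorem SchwartzMap.iteratedFDeriv_apply_eq_integral (f : 𝓢(E, ℂ)) (n : ℕ) (x y : E) :
    iteratedFDeriv ℝ n (fun z => f z) x (fun _ => y) =
      ∫ ξ : E, Complex.exp (((2 * Real.pi * inner ℝ x ξ : ℝ) : ℂ) * Complex.I) *
        (((2 * Real.pi * inner ℝ y ξ : ℝ) : ℂ) * Complex.I) ^ n * 𝓕 (fun z => f z) ξ := by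
  set g : E → ℂ := 𝓕 (fun z => f z) with hg
  have hgi : ∀ k : ℕ, Integrable (fun v => ‖v‖ ^ k * ‖g v‖) :=
    fun k => (𝓕 f).integrable_pow_mul volume k
  have hgc : Continuous g := (𝓕 f).continuous
  -- The pairing with a minus sign presents the inverse transform as a Fourier integral of `g`, so
  -- the differentiation formula for Fourier integrals applies to `f`.
  have hf : (fun z => f z) = VectorFourier.fourierIntegral Real.fourierChar volume
      (-innerSL ℝ : E →L[ℝ] E →L[ℝ] ℝ).toLinearMap₁₂ g := by
    have h1 : 𝓕⁻ g = fun z => f z :=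
      f.continuous.fourierInv_fourier_eq f.integrable (𝓕 f).integrable
    rw [← h1]
    ext w
    rw [Real.fourierInv_eq]
    simp [VectorFourier.fourierIntegral]
  rw [hf, VectorFourier.iteratedFDeriv_fourierIntegral (N := ⊤) _ (fun k _ => hgi k)
    hgc.aestronglyMeasurable le_top, VectorFourier.fourierIntegral_continuousMultilinearMap_apply
    Real.continuous_fourierChar
    (VectorFourier.integrable_fourierPowSMulRight _ (hgi n) hgc.aestronglyMeasurable)]
  simp only [VectorFourier.fourierIntegral]
  refine integral_congr_ae (Filter.Eventually.of_forall fun ξ => ?_)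
  simp only [VectorFourier.fourierPowSMulRight_apply, Circle.smul_def, Real.fourierChar_apply]
  simp only [real_inner_comm ξ]
  simp
  rw [innerSL_apply_apply, innerSL_apply_apply, ← mul_assoc (_ ^ n) (_ ^ n), ← mul_pow, ← mul_assoc]
  congr 3
  ring

end FourierRepresentation

/-! ### The operator, its convergence and its symbol. -/

section Operator

variable {d : ℕ}

theorem compensatedIncrement_eq (l : ℕ) (f : EuclideanSpace ℝ (Fin d) → ℂ)
    (x y : EuclideanSpace ℝ (Fin d)) : compensatedIncrement l f x y =
      f (x + y) - ∑ i ∈ Finset.range (2 * l + 1),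
        ((i ! : ℂ))⁻¹ * iteratedFDeriv ℝ i f x (fun _ => y) := by
  rw [compensatedIncrement, Finset.sum_range_succ', Finset.range_eq_Ico, Finset.sum_Ico_add'
    (fun i => ((i ! : ℂ))⁻¹ * iteratedFDeriv ℝ i f x (fun _ => y)) 0 (2 * l) 1]
  simp only [zero_add, Nat.factorial_zero, Nat.cast_one, inv_one, iteratedFDeriv_zero_apply, one_mul]
  rw [show Finset.Ico 1 (2 * l + 1) = Finset.Icc 1 (2 * l) from rfl]
  ring

theorem levyIntegrand_eq (l : ℕ) (α : ℝ)
    (h : EuclideanSpace ℝ (Fin d) → EuclideanSpace ℝ (Fin d) → ℝ)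
    (f : EuclideanSpace ℝ (Fin d) → ℂ) (x y : EuclideanSpace ℝ (Fin d)) :
    levyIntegrand l α h f x y = levyWeight l α y • (h x y • compensatedIncrement l f x y) := by
  rw [levyIntegrand, levyWeight, Complex.real_smul, Complex.real_smul, div_eq_mul_inv]
  push_cast
  ring

/-- Translation by `y` multiplies the transform by an exponential and the `i`-th derivative along
`y` by the `i`-th power of its exponent; subtracting the Taylor terms leaves the exponential tail.
-/
theorem compensatedIncrement_schwartz (l : ℕ) (f : 𝓢(EuclideanSpace ℝ (Fin d), ℂ))
    (x y : EuclideanSpace ℝ (Fin d)) : compensatedIncrement l (fun z => f z) x y =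
      ∫ ξ, Complex.exp (((2 * Real.pi * inner ℝ x ξ : ℝ) : ℂ) * Complex.I) *
        expTail (2 * l + 1) (2 * Real.pi * inner ℝ y ξ) * 𝓕 (fun z => f z) ξ := by
  have h0 : f (x + y) = ∫ ξ, Complex.exp (((2 * Real.pi * inner ℝ x ξ : ℝ) : ℂ) * Complex.I) *
      Complex.exp (((2 * Real.pi * inner ℝ y ξ : ℝ) : ℂ) * Complex.I) * 𝓕 (fun z => f z) ξ := by
    have := f.iteratedFDeriv_apply_eq_integral 0 (x + y) 0
    simp only [iteratedFDeriv_zero_apply, pow_zero, mul_one] at this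
    rw [this]
    refine integral_congr_ae (Filter.Eventually.of_forall fun ξ => ?_)
    simp only [inner_add_left, mul_add, Complex.ofReal_add, add_mul, Complex.exp_add]
  have h0i : Integrable fun ξ => Complex.exp (((2 * Real.pi * inner ℝ x ξ : ℝ) : ℂ) * Complex.I) *
      Complex.exp (((2 * Real.pi * inner ℝ y ξ : ℝ) : ℂ) * Complex.I) * 𝓕 (fun z => f z) ξ := by
    refine (f.integrable_exp_mul_pow_mul_fourier 0 (x + y) 0).congr
      (Filter.Eventually.of_forall fun ξ => ?_)
    simp only [inner_add_left, mul_add, Complex.ofReal_add, add_mul, Complex.exp_add, pow_zero,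
      mul_one]
  rw [compensatedIncrement_eq, h0]
  simp only [f.iteratedFDeriv_apply_eq_integral, ← integral_const_mul]
  rw [← integral_finsetSum _ fun i _ => (f.integrable_exp_mul_pow_mul_fourier i x y).const_mul _,
    ← integral_sub h0i (integrable_finsetSum _ fun i _ =>
      (f.integrable_exp_mul_pow_mul_fourier i x y).const_mul _)]
  refine integral_congr_ae (Filter.Eventually.of_forall fun ξ => ?_)
  simp only [expTail, mul_sub, sub_mul, Finset.mul_sum, Finset.sum_mul]
  congr 1
  refine Finset.sum_congr rfl fun i _ => ?_
  ring

theorem exists_norm_compensatedIncrement_le (l : ℕ) {f : EuclideanSpace ℝ (Fin d) → ℂ}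
    (hf : ContDiff ℝ ∞ f) (x : EuclideanSpace ℝ (Fin d)) {C : ℝ} (hC : 0 ≤ C) :
    ∃ A : ℝ, ∀ y, ‖y‖ ≤ C → ‖compensatedIncrement l f x y‖ ≤ A * ‖y‖ ^ (2 * l) := by
  have hcont : Continuous (iteratedFDeriv ℝ (2 * l + 1) f) :=
    (contDiff_infty.1 hf (2 * l + 1)).continuous_iteratedFDeriv le_rfl
  obtain ⟨S, hS⟩ := (isCompact_closedBall x C).exists_bound_of_continuousOn hcont.continuousOn
  have hS0 : 0 ≤ S := (norm_nonneg _).trans (hS x (Metric.mem_closedBall_self hC))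
  -- The Taylor remainder is of size `S ‖y‖ ^ (2l+1)`; one factor `‖y‖ ≤ C` goes into the constant.
  refine ⟨S * C, fun y hy => ?_⟩
  have key := map_add_eq_sum_add_integral_iteratedFDeriv (f := f) (x := x) (y := y) (n := 2 * l)
    fun t _ => (by exact_mod_cast contDiff_infty.1 hf (2 * l + 1) :
      ContDiff ℝ ((2 * l : ℕ) + 1) f).contDiffAt
  have e : compensatedIncrement l f x y = (((2 * l)! : ℕ) : ℝ)⁻¹ • ∫ t in (0 : ℝ)..1,
      (1 - t) ^ (2 * l) • iteratedFDeriv ℝ (2 * l + 1) f (x + t • y) (fun _ ↦ y) := by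
    rw [compensatedIncrement_eq, key, add_sub_right_comm, add_eq_right, sub_eq_zero]
    simp [Complex.real_smul]
  have hI : ‖∫ t in (0 : ℝ)..1, (1 - t) ^ (2 * l) •
      iteratedFDeriv ℝ (2 * l + 1) f (x + t • y) (fun _ ↦ y)‖ ≤
      S * ‖y‖ ^ (2 * l + 1) * |(1 : ℝ) - 0| := by
    refine intervalIntegral.norm_integral_le_of_norm_le_const fun t ht => ?_
    rw [Set.uIoc_of_le zero_le_one] at ht
    have hm : x + t • y ∈ Metric.closedBall x C := by
      rw [mem_closedBall_iff_norm, add_sub_cancel_left, norm_smul, Real.norm_of_nonneg ht.1.le]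
      exact (mul_le_of_le_one_left (norm_nonneg _) ht.2).trans hy
    rw [norm_smul, norm_pow, Real.norm_of_nonneg (by linarith [ht.2])]
    refine (mul_le_of_le_one_left (norm_nonneg _)
      (pow_le_one₀ (by linarith [ht.2]) (by linarith [ht.1]))).trans ?_
    refine (ContinuousMultilinearMap.le_opNorm _ _).trans ?_
    rw [Finset.prod_const, Finset.card_univ, Fintype.card_fin]
    gcongr
    exact hS _ hm
  rw [e, norm_smul, norm_inv, Real.norm_natCast]
  calc _ ≤ 1 * (S * ‖y‖ ^ (2 * l + 1) * |(1 : ℝ) - 0|) := by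
        gcongr
        exact inv_le_one_of_one_le₀ (by exact_mod_cast Nat.factorial_pos _)
    _ = S * ‖y‖ * ‖y‖ ^ (2 * l) := by rw [sub_zero, abs_one]; ring
    _ ≤ _ := by gcongr

namespace IsLevyDensity

variable {h : EuclideanSpace ℝ (Fin d) → EuclideanSpace ℝ (Fin d) → ℝ} {C : ℝ} {B : ℕ → ℝ}
  (H : IsLevyDensity h C B) [Nontrivial (EuclideanSpace ℝ (Fin d))]
include H

theorem integrable_levyIntegrand (l : ℕ) {α : ℝ} (hα : α ∈ Set.Ioo (-1 : ℝ) 0)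
    {f : EuclideanSpace ℝ (Fin d) → ℂ} (hf : ContDiff ℝ ∞ f) (x : EuclideanSpace ℝ (Fin d)) :
    Integrable fun y => levyIntegrand l α h f x y := by
  obtain ⟨A, hA⟩ := exists_norm_compensatedIncrement_le l hf x H.radius_nonneg
  simp only [levyIntegrand_eq]
  refine H.integrable_levyWeight_smul hα ?_ hA x
  have := hf.continuous
  unfold compensatedIncrement
  fun_prop

/-- Fubini, with a product majorant: the truncated moment in `y` times `‖ξ‖ ^ (2l) ‖g ξ‖`,
integrable since `g` is Schwartz. -/
theorem levyOperator_schwartz (l : ℕ) {α : ℝ} (hα : α ∈ Set.Ioo (-1 : ℝ) 0)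
    (f : 𝓢(EuclideanSpace ℝ (Fin d), ℂ)) (x : EuclideanSpace ℝ (Fin d)) :
    levyOperator l α h (fun z => f z) x =
      symbolOperator (fun x ξ => (-1) ^ (l + 1) * levySymbol l α h x ξ) (fun z => f z) x := by
  set g := 𝓕 (fun z => f z) with hg
  have hgc : Continuous g := (𝓕 f).continuous
  have hint : Integrable (Function.uncurry fun y ξ : EuclideanSpace ℝ (Fin d) => levyWeight l α y •
      (h x y • (Complex.exp (((2 * Real.pi * inner ℝ x ξ : ℝ) : ℂ) * Complex.I) *
        expTail (2 * l + 1) (2 * Real.pi * inner ℝ y ξ) * g ξ))) (volume.prod volume) := by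
    refine (((integrable_truncatedMoment l hα C).const_mul (2 * B 0 * (2 * Real.pi) ^ (2 * l))).mul_prod
      ((𝓕 f).integrable_pow_mul volume (2 * l))).mono' ?_ (Filter.Eventually.of_forall ?_)
    · refine ((measurable_levyWeight l α).comp measurable_fst).aestronglyMeasurable.smul
        (Continuous.aestronglyMeasurable ?_)
      have h1 := H.smooth.continuous
      have h2 := (contDiff_expTail (2 * l + 1)).continuous
      refine Continuous.smul (h1.comp (by fun_prop : Continuous
        fun z : EuclideanSpace ℝ (Fin d) × EuclideanSpace ℝ (Fin d) => (x, z.1))) ?_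
      fun_prop
    · rintro ⟨y, ξ⟩
      simp only [Function.uncurry_apply_pair]
      rw [norm_smul, Real.norm_of_nonneg (levyWeight_nonneg _ _ _)]
      refine (levyWeight_mul_le_truncatedMoment (C := C)
        (A := 2 * B 0 * (2 * Real.pi) ^ (2 * l) * (‖ξ‖ ^ (2 * l) * ‖g ξ‖))
        (fun hy => ?_) (fun hy => ?_)).trans_eq ?_
      · rw [norm_smul, norm_mul, norm_mul, Complex.norm_exp_ofReal_mul_I, one_mul]
        have h3 : ‖expTail (2 * l + 1) (2 * Real.pi * inner ℝ y ξ)‖ ≤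
            2 * (2 * Real.pi * (‖y‖ * ‖ξ‖)) ^ (2 * l) := by
          refine (norm_expTail_succ_le _ _).trans ?_
          rw [abs_mul, abs_of_pos Real.two_pi_pos]
          have := Real.two_pi_pos
          gcongr
          exact abs_real_inner_le_norm y ξ
        calc _ ≤ B 0 * (2 * (2 * Real.pi * (‖y‖ * ‖ξ‖)) ^ (2 * l) * ‖g ξ‖) := by
              have := H.bound_nonneg 0
              gcongr
              exact H.abs_le x y
          _ = _ := by ring
      · rw [H.supp x y hy, zero_smul, norm_zero]
      · simp only [hg, SchwartzMap.fourier_coe]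
        ring
  have hL : ∀ y, levyIntegrand l α h (fun z => f z) x y = ∫ ξ, levyWeight l α y •
      (h x y • (Complex.exp (((2 * Real.pi * inner ℝ x ξ : ℝ) : ℂ) * Complex.I) *
        expTail (2 * l + 1) (2 * Real.pi * inner ℝ y ξ) * g ξ)) := fun y => by
    rw [levyIntegrand_eq, compensatedIncrement_schwartz, ← integral_smul, ← integral_smul]
  rw [levyOperator, symbolOperator]
  simp only [hL]
  rw [integral_integral_swap hint, ← integral_const_mul]
  refine integral_congr_ae (Filter.Eventually.of_forall fun ξ => ?_)
  simp only [levySymbol, ← integral_const_mul, ← integral_mul_const]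
  refine integral_congr_ae (Filter.Eventually.of_forall fun y => ?_)
  simp only [real_inner_smul_right, Complex.real_smul]
  ring

end IsLevyDensity

theorem IsSymbolOfOrder.const_mul
    {a : EuclideanSpace ℝ (Fin d) → EuclideanSpace ℝ (Fin d) → ℂ} {m : ℝ} (ha : IsSymbolOfOrder a m)
    (c : ℂ) : IsSymbolOfOrder (fun x ξ => c * a x ξ) m where
  smooth := contDiff_const.mul ha.smooth
  bound r j := by
    obtain ⟨C, hC⟩ := ha.bound r j
    refine ⟨‖c‖ * C, fun x ξ => ?_⟩
    have h1 : ∀ x, ContDiff ℝ ∞ (a x) := fun x => ha.smooth.comp (contDiff_prodMk_right x)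
    have h2 : ∀ x, iteratedFDeriv ℝ j (fun ξ' => c * a x ξ') ξ = c • iteratedFDeriv ℝ j (a x) ξ :=
      fun x => by
        have := iteratedFDeriv_const_smul_apply' (i := j) (a := c) (x := ξ)
          ((h1 x).of_le (by exact_mod_cast le_top)).contDiffAt
        exact this
    have h3 : ContDiff ℝ ∞ fun x => iteratedFDeriv ℝ j (a x) ξ :=
      (contDiff_iteratedFDeriv_partial_left (g := fun z => a z.2 z.1)
        (ha.smooth.comp (contDiff_snd.prodMk contDiff_fst)) j).comp (contDiff_prodMk_right ξ)
    simp only [h2]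
    rw [iteratedFDeriv_const_smul_apply' (h3.of_le (by exact_mod_cast le_top)).contDiffAt, norm_smul,
      mul_assoc, ← mul_add]
    exact mul_le_mul_of_nonneg_left (hC x ξ) (norm_nonneg c)

theorem IsLevyDensity.isSymbolOfOrder_levySymbol [Nontrivial (EuclideanSpace ℝ (Fin d))]
    {h : EuclideanSpace ℝ (Fin d) → EuclideanSpace ℝ (Fin d) → ℝ} {C : ℝ} {B : ℕ → ℝ}
    (H : IsLevyDensity h C B) (l : ℕ) {α : ℝ} (hα : α ∈ Set.Ioo (-1 : ℝ) 0) :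
    IsSymbolOfOrder (levySymbol l α h) (2 * (l : ℝ)) where
  smooth := H.contDiff_levySymbol l hα
  bound r j := by
    obtain ⟨K, hK, hle⟩ := H.norm_iteratedFDeriv_levySymbol_le l hα r j
    -- For `j > 2l` the bound reads `K (1 + 1)`, whence the factor `2`. In that case the real power
    -- enters only through its nonnegativity, so its value at `ξ = 0` is harmless.
    refine ⟨2 * K, fun x ξ => (hle x ξ).trans ?_⟩
    rcases le_or_gt j (2 * l) with hj | hj
    · have e : ‖ξ‖ ^ (2 * (l : ℝ) - j) = ‖ξ‖ ^ (2 * l - j) := by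
        rw [← Real.rpow_natCast, Nat.cast_sub hj]
        push_cast
        rfl
      rw [e]
      have : 0 ≤ ‖ξ‖ ^ (2 * l - j) := by positivity
      nlinarith
    · rw [Nat.sub_eq_zero_of_le hj.le, pow_zero]
      have : 0 ≤ ‖ξ‖ ^ (2 * (l : ℝ) - j) := by positivity
      nlinarith

end Operator

theorem theorem10 (d : ℕ) (hd : 1 ≤ d) (l : ℕ) (hl : 1 ≤ l) (α : ℝ) (hα : α ∈ Set.Ioo (-1 : ℝ) 0)
    (h : EuclideanSpace ℝ (Fin d) → EuclideanSpace ℝ (Fin d) → ℝ)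
    (h_smooth : ContDiff ℝ ∞ (Function.uncurry h))
    (h_bdd : ∀ n : ℕ, ∃ C : ℝ, ∀ p : EuclideanSpace ℝ (Fin d) × EuclideanSpace ℝ (Fin d),
      ‖iteratedFDeriv ℝ n (Function.uncurry h) p‖ ≤ C)
    (h_nonneg : ∀ x y, 0 ≤ h x y)
    (h_supp : ∃ C : ℝ, ∀ x y, C < ‖y‖ → h x y = 0)
    (h_one : ∀ x, h x 0 = 1) :
    (∀ f : EuclideanSpace ℝ (Fin d) → ℂ, ContDiff ℝ ∞ f →
      ∀ x, Integrable (fun y => levyIntegrand l α h f x y)) ∧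
    IsEllipticPseudodifferential (levyOperator l α h) (2 * (l : ℝ)) (2 * (l : ℝ)) := by
  have : NeZero d := ⟨by omega⟩
  choose B hB using h_bdd
  obtain ⟨C, hC⟩ := h_supp
  have H : IsLevyDensity h (max C 0) B :=
    ⟨h_smooth, le_max_right _ _, hB, fun x y hy => hC x y ((le_max_left _ _).trans_lt hy)⟩
  refine ⟨fun f hf x => H.integrable_levyIntegrand l hα hf x,
    fun x ξ => (-1) ^ (l + 1) * levySymbol l α h x ξ,
    (H.isSymbolOfOrder_levySymbol l hα).const_mul _, ⟨by positivity, ?_⟩,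
    H.levyOperator_schwartz l hα⟩
  obtain ⟨c, R, hc, hcR⟩ := H.exists_le_norm_levySymbol h_nonneg h_one hl hα
  refine ⟨c, R, hc, fun x ξ hξ => ?_⟩
  rw [norm_mul, norm_pow, norm_neg, norm_one, one_pow, one_mul]
  exact_mod_cast hcR x ξ hξ
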